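/- **Corollary 4.12.** For a tensor $T\in\mathbb R^{n_1}\otimes\mathbb R^{n_2}\otimes\mathbb R^{n_3}$, let the (real) subrank $Q(T)$ be the largest integer $r\ge 0$ for which there exist $\mathbb R$-linear maps $\varphi_i:\mathbb R^{n_i}\to\mathbb R^r$ $(i=1,2,3)$ with $$(\varphi_1\otimes\varphi_2\otimes\varphi_3)\,T=\sum_{j=1}^r e_j\otimes e_j\otimes e_j .$$ An integer $r\ge 0$ is called a *typical subrank* of real $n_1\times n_2\times n_3$ tensors if the set $\{T\in\mathbb R^{n_1}\otimes\mathbb R^{n_2}\otimes\mathbb R^{n_3} : Q(T)=r\}$ contains a nonempty subset that is open in the Euclidean topology. The typical subranks of real $3\times4\times4$ tensors are exactly $2$ and $3$. -/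

import Mathlib

open scoped TensorProduct

/-- The `r`-th unit tensor `∑ j, e_j ⊗ e_j ⊗ e_j` in `k^r ⊗ k^r ⊗ k^r`. -/
noncomputable def unitTensor (k : Type*) [Field k] (r : ℕ) :
    ((Fin r → k) ⊗[k] (Fin r → k)) ⊗[k] (Fin r → k) :=
  ∑ j : Fin r, (Pi.single j (1 : k) ⊗ₜ[k] Pi.single j (1 : k)) ⊗ₜ[k] Pi.single j (1 : k)

/-- `T` restricts to the `r`-th unit tensor: there are linear maps `φᵢ : Vᵢ → k^r` with
`(φ₁ ⊗ φ₂ ⊗ φ₃) T = I_r`. -/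
def RestrictsToUnit {k V₁ V₂ V₃ : Type*} [Field k]
    [AddCommGroup V₁] [Module k V₁] [AddCommGroup V₂] [Module k V₂]
    [AddCommGroup V₃] [Module k V₃] (T : (V₁ ⊗[k] V₂) ⊗[k] V₃) (r : ℕ) : Prop :=
  ∃ (φ₁ : V₁ →ₗ[k] (Fin r → k)) (φ₂ : V₂ →ₗ[k] (Fin r → k)) (φ₃ : V₃ →ₗ[k] (Fin r → k)),
    TensorProduct.map (TensorProduct.map φ₁ φ₂) φ₃ T = unitTensor k r

/-- The subrank of a tensor of order three: the largest `r` such that `T` restricts to the `r`-th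
unit tensor. The maximum exists by `subrank_isGreatest` below. -/
noncomputable def subrank {k V₁ V₂ V₃ : Type*} [Field k]
    [AddCommGroup V₁] [Module k V₁] [AddCommGroup V₂] [Module k V₂]
    [AddCommGroup V₃] [Module k V₃] (T : (V₁ ⊗[k] V₂) ⊗[k] V₃) : ℕ :=
  sSup {r : ℕ | RestrictsToUnit T r}

theorem RestrictsToUnit.le_finrank {k V₁ V₂ V₃ : Type*} [Field k]
    [AddCommGroup V₁] [Module k V₁] [AddCommGroup V₂] [Module k V₂]
    [AddCommGroup V₃] [Module k V₃] [FiniteDimensional k V₃]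
    {T : (V₁ ⊗[k] V₂) ⊗[k] V₃} {r : ℕ} (h : RestrictsToUnit T r) :
    r ≤ Module.finrank k V₃ := by
  obtain ⟨φ₁, φ₂, φ₃, h⟩ := h
  -- contraction of the first two factors with the coordinate functional `e_i* ⊗ e_i*`
  let c (i : Fin r) : ((Fin r → k) ⊗[k] (Fin r → k)) →ₗ[k] k :=
    LinearMap.mul' k k ∘ₗ TensorProduct.map (LinearMap.proj i) (LinearMap.proj i)
  let C (i : Fin r) : (((Fin r → k) ⊗[k] (Fin r → k)) ⊗[k] (Fin r → k)) →ₗ[k] (Fin r → k) :=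
    (TensorProduct.lid k (Fin r → k)).toLinearMap ∘ₗ (c i).rTensor (Fin r → k)
  have hrange (i : Fin r) (S : (V₁ ⊗[k] V₂) ⊗[k] V₃) :
      C i (TensorProduct.map (TensorProduct.map φ₁ φ₂) φ₃ S) ∈ LinearMap.range φ₃ := by
    induction S using TensorProduct.induction_on with
    | zero => simp
    | add x y hx hy => rw [map_add, map_add]; exact add_mem hx hy
    | tmul x y =>
      refine ⟨c i (TensorProduct.map φ₁ φ₂ x) • y, ?_⟩
      simp [C]
  have hunit (i : Fin r) : C i (unitTensor k r) = Pi.single i (1 : k) := by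
    simp [C, c, unitTensor, Pi.single_apply]
  have hsurj : Function.Surjective φ₃ := by
    rw [← LinearMap.range_eq_top, eq_top_iff, ← (Pi.basisFun k (Fin r)).span_eq,
      Submodule.span_le]
    rintro _ ⟨i, rfl⟩
    have := hrange i T
    rw [h, hunit] at this
    simpa using this
  simpa using LinearMap.finrank_le_finrank_of_surjective hsurj

/-- For finite-dimensional spaces, the subrank is a genuine maximum. -/
theorem subrank_isGreatest {k V₁ V₂ V₃ : Type*} [Field k]
    [AddCommGroup V₁] [Module k V₁] [AddCommGroup V₂] [Module k V₂]
    [AddCommGroup V₃] [Module k V₃] [FiniteDimensional k V₃]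
    (T : (V₁ ⊗[k] V₂) ⊗[k] V₃) :
    IsGreatest {r : ℕ | RestrictsToUnit T r} (subrank T) := by
  have hb : BddAbove {r : ℕ | RestrictsToUnit T r} :=
    ⟨Module.finrank k V₃, fun _ hr => hr.le_finrank⟩
  have hn : {r : ℕ | RestrictsToUnit T r}.Nonempty := by
    refine ⟨0, 0, 0, 0, ?_⟩
    simp [unitTensor]
  exact ⟨Nat.sSup_mem hn hb, fun _ hr => le_csSup hb hr⟩

/-- The space `ℝ^n₁ ⊗ ℝ^n₂ ⊗ ℝ^n₃` of real `n₁ × n₂ × n₃` tensors. It carries Mathlib's inner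
product on tensor products of inner product spaces, hence the Euclidean topology. -/
abbrev RealTensor (n₁ n₂ n₃ : ℕ) : Type :=
  (EuclideanSpace ℝ (Fin n₁) ⊗[ℝ] EuclideanSpace ℝ (Fin n₂)) ⊗[ℝ] EuclideanSpace ℝ (Fin n₃)

/-- `r` is a typical subrank of real `n₁ × n₂ × n₃` tensors: the set of tensors with (real)
subrank `r` contains a nonempty open set. -/
def IsTypicalSubrank (n₁ n₂ n₃ r : ℕ) : Prop :=
  ∃ U : Set (RealTensor n₁ n₂ n₃), IsOpen U ∧ U.Nonempty ∧ U ⊆ {T | subrank T = r}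

/-! The subrank is at most 3 by flattening along the first factor, and at least 2 off the zero set
of one determinant (`cornerMatrix`), which has dense complement; so only 2 and 3 can be typical.

Value 2 is attained near the quaternion tensor. Restriction to the unit tensor of size three forces
a nonzero combination of the `4 × 4` slices to be singular (`exists_det_slicePencil_eq_zero`).
Multiplication by a nonzero imaginary quaternion is invertible, and by compactness of the sphere
this persists for all nearby tensors.

Value 3 is attained near `stableCoords`: there the restriction map is a submersion in the three
matrices, so the unit tensor stays reachable from nearby tensors (`eventually_exists_contract_eq`).
-/

/-! ### Restrictions in coordinates -/

/-- The linear combination of the slices of a tensor with coefficient vector `x`. -/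
def slicePencil {n₁ n₂ n₃ : ℕ} (S : (Fin n₁ × Fin n₂) × Fin n₃ → ℝ) (x : Fin n₁ → ℝ) :
    Matrix (Fin n₂) (Fin n₃) ℝ :=
  Matrix.of fun j k => ∑ i, x i * S ((i, j), k)

/-- The coordinates of `(A ⊗ B ⊗ C) S`. -/
def contract {n₁ n₂ n₃ r : ℕ} (A : Fin r → Fin n₁ → ℝ) (B : Fin r → Fin n₂ → ℝ)
    (C : Fin r → Fin n₃ → ℝ) (S : (Fin n₁ × Fin n₂) × Fin n₃ → ℝ) (a b c : Fin r) : ℝ :=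
  ∑ i, ∑ j, ∑ k, A a i * B b j * C c k * S ((i, j), k)

/-- The coordinates of the unit tensor. -/
def unitCoord (r : ℕ) (a b c : Fin r) : ℝ := if a = b ∧ b = c then 1 else 0

theorem contract_eq_mul {n₁ n₂ n₃ r : ℕ} (A : Fin r → Fin n₁ → ℝ) (B : Fin r → Fin n₂ → ℝ)
    (C : Fin r → Fin n₃ → ℝ) (S : (Fin n₁ × Fin n₂) × Fin n₃ → ℝ) (a b c : Fin r) :
    contract A B C S a b c =
      (Matrix.of B * slicePencil S (A a) * (Matrix.of C).transpose) b c := by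
  simp only [contract, slicePencil, Matrix.mul_apply, Matrix.of_apply, Matrix.transpose_apply,
    Finset.mul_sum, Finset.sum_mul]
  rw [Finset.sum_comm' (t' := Finset.univ) (s' := fun _ => Finset.univ) (by simp)]
  rw [Finset.sum_congr rfl fun j _ => Finset.sum_comm]
  rw [Finset.sum_comm]
  refine Finset.sum_congr rfl fun k _ => Finset.sum_congr rfl fun j _ =>
    Finset.sum_congr rfl fun i _ => by ring

/-- The coordinates of a tensor with respect to the standard bases. -/
noncomputable def tensorCoords (n₁ n₂ n₃ : ℕ) :
    RealTensor n₁ n₂ n₃ ≃ₗ[ℝ] ((Fin n₁ × Fin n₂) × Fin n₃ → ℝ) :=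
  (((EuclideanSpace.basisFun (Fin n₁) ℝ).toBasis.tensorProduct
    (EuclideanSpace.basisFun (Fin n₂) ℝ).toBasis).tensorProduct
    (EuclideanSpace.basisFun (Fin n₃) ℝ).toBasis).equivFun

theorem tensorCoords_tmul {n₁ n₂ n₃ : ℕ} (x : EuclideanSpace ℝ (Fin n₁))
    (y : EuclideanSpace ℝ (Fin n₂)) (z : EuclideanSpace ℝ (Fin n₃)) (i : Fin n₁) (j : Fin n₂)
    (k : Fin n₃) : tensorCoords n₁ n₂ n₃ ((x ⊗ₜ y) ⊗ₜ z) ((i, j), k) = x i * y j * z k := by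
  simp [tensorCoords, Module.Basis.equivFun_apply]
  ring

/-- The coordinates of a tensor in `(ℝ^r)^{⊗3}` with respect to the standard bases. -/
noncomputable def cubeCoords (r : ℕ) :
    ((Fin r → ℝ) ⊗[ℝ] (Fin r → ℝ)) ⊗[ℝ] (Fin r → ℝ) ≃ₗ[ℝ] ((Fin r × Fin r) × Fin r → ℝ) :=
  (((Pi.basisFun ℝ (Fin r)).tensorProduct (Pi.basisFun ℝ (Fin r))).tensorProduct
    (Pi.basisFun ℝ (Fin r))).equivFun

theorem cubeCoords_tmul {r : ℕ} (x y z : Fin r → ℝ) (i j k : Fin r) :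
    cubeCoords r ((x ⊗ₜ y) ⊗ₜ z) ((i, j), k) = x i * y j * z k := by
  simp [cubeCoords, Module.Basis.equivFun_apply]
  ring

theorem cubeCoords_unitTensor (r : ℕ) (a b c : Fin r) :
    cubeCoords r (unitTensor ℝ r) ((a, b), c) = unitCoord r a b c := by
  rw [unitTensor, map_sum, Finset.sum_apply]
  simp only [cubeCoords_tmul, Pi.single_apply, unitCoord]
  rw [Finset.sum_eq_single a (by intro j _ hj; simp [Ne.symm hj]) (by simp)]
  by_cases h : a = b
  · subst h; simp [eq_comm]
  · simp [h, Ne.symm h]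

theorem cubeCoords_map {n₁ n₂ n₃ r : ℕ} (A : Fin r → Fin n₁ → ℝ) (B : Fin r → Fin n₂ → ℝ)
    (C : Fin r → Fin n₃ → ℝ) (φ₁ : EuclideanSpace ℝ (Fin n₁) →ₗ[ℝ] (Fin r → ℝ))
    (φ₂ : EuclideanSpace ℝ (Fin n₂) →ₗ[ℝ] (Fin r → ℝ))
    (φ₃ : EuclideanSpace ℝ (Fin n₃) →ₗ[ℝ] (Fin r → ℝ))
    (h₁ : ∀ x a, φ₁ x a = ∑ i, A a i * x i) (h₂ : ∀ x a, φ₂ x a = ∑ i, B a i * x i)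
    (h₃ : ∀ x a, φ₃ x a = ∑ i, C a i * x i) (T : RealTensor n₁ n₂ n₃) (a b c : Fin r) :
    cubeCoords r (TensorProduct.map (TensorProduct.map φ₁ φ₂) φ₃ T) ((a, b), c) =
      contract A B C (tensorCoords n₁ n₂ n₃ T) a b c := by
  induction T using TensorProduct.induction_on with
  | zero =>
    rw [LinearMap.map_zero, LinearEquiv.map_zero, LinearEquiv.map_zero]
    simp [contract]
  | add S T hS hT =>
    rw [map_add, map_add, map_add, Pi.add_apply, hS, hT]
    simp only [contract, Pi.add_apply, mul_add, Finset.sum_add_distrib]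
  | tmul w z =>
    induction w using TensorProduct.induction_on with
    | zero =>
      rw [TensorProduct.zero_tmul, LinearMap.map_zero, LinearEquiv.map_zero, LinearEquiv.map_zero]
      simp [contract]
    | add S T hS hT =>
      rw [TensorProduct.add_tmul, map_add, map_add, map_add, Pi.add_apply, hS, hT]
      simp only [contract, Pi.add_apply, mul_add, Finset.sum_add_distrib]
    | tmul x y =>
      rw [TensorProduct.map_tmul, TensorProduct.map_tmul, cubeCoords_tmul, h₁, h₂, h₃]
      simp only [contract, tensorCoords_tmul]
      rw [Finset.sum_mul_sum, Finset.sum_mul]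
      refine Finset.sum_congr rfl fun i _ => ?_
      rw [Finset.sum_mul_sum]
      exact Finset.sum_congr rfl fun j _ => Finset.sum_congr rfl fun k _ => by ring

/-- The linear map `ℝ^n → ℝ^r` with a given matrix. -/
noncomputable def coordMap {n r : ℕ} (A : Fin r → Fin n → ℝ) :
    EuclideanSpace ℝ (Fin n) →ₗ[ℝ] (Fin r → ℝ) :=
  (Matrix.of A).mulVecLin ∘ₗ (WithLp.linearEquiv 2 ℝ (Fin n → ℝ)).toLinearMap

theorem coordMap_apply {n r : ℕ} (A : Fin r → Fin n → ℝ) (x : EuclideanSpace ℝ (Fin n))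
    (a : Fin r) : coordMap A x a = ∑ i, A a i * x i := by
  simp [coordMap, Matrix.mulVec, dotProduct]

theorem exists_coord {n r : ℕ} (φ : EuclideanSpace ℝ (Fin n) →ₗ[ℝ] (Fin r → ℝ)) :
    ∃ A : Fin r → Fin n → ℝ, ∀ x a, φ x a = ∑ i, A a i * x i := by
  refine ⟨fun a i => φ (EuclideanSpace.basisFun (Fin n) ℝ i) a, fun x a => ?_⟩
  conv_lhs => rw [← (EuclideanSpace.basisFun (Fin n) ℝ).sum_repr x]
  simp [mul_comm]

theorem restrictsToUnit_iff {n₁ n₂ n₃ : ℕ} (T : RealTensor n₁ n₂ n₃) (r : ℕ) :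
    RestrictsToUnit T r ↔ ∃ (A : Fin r → Fin n₁ → ℝ) (B : Fin r → Fin n₂ → ℝ)
      (C : Fin r → Fin n₃ → ℝ), contract A B C (tensorCoords n₁ n₂ n₃ T) = unitCoord r := by
  constructor
  · rintro ⟨φ₁, φ₂, φ₃, h⟩
    obtain ⟨A, hA⟩ := exists_coord φ₁
    obtain ⟨B, hB⟩ := exists_coord φ₂
    obtain ⟨C, hC⟩ := exists_coord φ₃
    refine ⟨A, B, C, ?_⟩
    funext a b c
    rw [← cubeCoords_map A B C φ₁ φ₂ φ₃ hA hB hC, h, cubeCoords_unitTensor]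
  · rintro ⟨A, B, C, h⟩
    refine ⟨coordMap A, coordMap B, coordMap C, (cubeCoords r).injective ?_⟩
    funext ⟨⟨a, b⟩, c⟩
    rw [cubeCoords_map A B C _ _ _ (coordMap_apply A) (coordMap_apply B) (coordMap_apply C), h,
      cubeCoords_unitTensor]

/-! ### Bounds and monotonicity -/

theorem le_of_contract_eq {n₁ n₂ n₃ r : ℕ} {A : Fin r → Fin n₁ → ℝ} {B : Fin r → Fin n₂ → ℝ}
    {C : Fin r → Fin n₃ → ℝ} {S : (Fin n₁ × Fin n₂) × Fin n₃ → ℝ}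
    (h : contract A B C S = unitCoord r) : r ≤ n₁ := by
  -- On the entries with `b = c` the unit tensor is the identity matrix, so it factors through
  -- `ℝ^n₁`.
  have key : Matrix.of A * (Matrix.of fun i c => ∑ j, ∑ k, B c j * C c k * S ((i, j), k)) = 1 := by
    ext a c
    have := congrFun (congrFun (congrFun h a) c) c
    simp only [contract, unitCoord, and_true] at this
    rw [Matrix.mul_apply, Matrix.one_apply, ← this]
    refine Finset.sum_congr rfl fun i _ => ?_
    simp only [Matrix.of_apply, Finset.mul_sum]
    exact Finset.sum_congr rfl fun j _ => Finset.sum_congr rfl fun k _ => by ring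
  have h1 := Matrix.rank_mul_le_left (Matrix.of A)
    (Matrix.of fun i c => ∑ j, ∑ k, B c j * C c k * S ((i, j), k))
  rw [key, Matrix.rank_one, Fintype.card_fin] at h1
  simpa using h1.trans (Matrix.rank_le_width _)

theorem subrank_le_left {n₁ n₂ n₃ : ℕ} (T : RealTensor n₁ n₂ n₃) : subrank T ≤ n₁ := by
  obtain ⟨A, B, C, h⟩ := (restrictsToUnit_iff T _).1 (subrank_isGreatest T).1
  exact le_of_contract_eq h

theorem RestrictsToUnit.mono {n₁ n₂ n₃ : ℕ} {T : RealTensor n₁ n₂ n₃} {r s : ℕ}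
    (h : RestrictsToUnit T s) (hrs : r ≤ s) : RestrictsToUnit T r := by
  obtain ⟨A, B, C, h⟩ := (restrictsToUnit_iff T _).1 h
  refine (restrictsToUnit_iff T _).2 ⟨fun a => A (Fin.castLE hrs a), fun a => B (Fin.castLE hrs a),
    fun a => C (Fin.castLE hrs a), ?_⟩
  funext a b c
  have := congrFun (congrFun (congrFun h (Fin.castLE hrs a)) (Fin.castLE hrs b)) (Fin.castLE hrs c)
  simpa [contract, unitCoord] using this

/-! ### Singular slices as an obstruction to subrank three -/

/-- A tensor restricting to the unit tensor of size three has a nontrivial singular combination of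
its slices, since some combination has a compression of rank one to codimension one. -/
theorem exists_det_slicePencil_eq_zero {n₁ : ℕ} {A : Fin 3 → Fin n₁ → ℝ} {B C : Fin 3 → Fin 4 → ℝ}
    {S : (Fin n₁ × Fin 4) × Fin 4 → ℝ} (h : contract A B C S = unitCoord 3) :
    A 0 ≠ 0 ∧ (slicePencil S (A 0)).det = 0 := by
  have hs (a : Fin 3) : Matrix.of B * slicePencil S (A a) * (Matrix.of C).transpose =
      Matrix.of (unitCoord 3 a) := by
    ext b c
    rw [← contract_eq_mul, h, Matrix.of_apply]
  have hsum : Matrix.of B * (∑ a, slicePencil S (A a)) * (Matrix.of C).transpose = 1 := by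
    rw [Matrix.mul_sum, Matrix.sum_mul, Finset.sum_congr rfl fun a _ => hs a]
    ext b c
    simp only [Matrix.sum_apply, Matrix.of_apply, unitCoord, Matrix.one_apply]
    by_cases hbc : b = c <;> simp [hbc]
  refine ⟨fun h0 => ?_, ?_⟩
  · have := congrFun (congrFun (congrFun h 0) 0) 0
    simp [contract, unitCoord, h0] at this
  · by_contra hdet
    set M := slicePencil S (A 0) with hM
    set N := ∑ a, slicePencil S (A a) with hN
    -- `E` discards coordinate 0, the only one in which the compression of `M` is nonzero. If `M`
    -- were invertible, `M * Cᵀ * E` would have rank 2 with columns in the kernel of `B`, which has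
    -- dimension 1.
    let E : Matrix (Fin 3) (Fin 2) ℝ := Matrix.of fun i j => if i = j.succ then 1 else 0
    have hE : E.transpose * E = 1 := by
      ext i j; fin_cases i <;> fin_cases j <;> simp [E, Matrix.mul_apply]
    have h0 : Matrix.of B * (M * (Matrix.of C).transpose * E) = 0 := by
      rw [← Matrix.mul_assoc, ← Matrix.mul_assoc, hs]
      ext b j
      fin_cases b <;> fin_cases j <;>
        simp [E, Matrix.mul_apply, unitCoord]
    have hB : 3 ≤ (Matrix.of B).rank := by
      have := Matrix.rank_mul_le_left (Matrix.of B) (N * (Matrix.of C).transpose)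
      rwa [← Matrix.mul_assoc, hsum, Matrix.rank_one, Fintype.card_fin] at this
    have hK : 2 ≤ (M * (Matrix.of C).transpose * E).rank := by
      have := Matrix.rank_mul_le_right (E.transpose * (Matrix.of B * N) * M⁻¹)
        (M * (Matrix.of C).transpose * E)
      have e : E.transpose * (Matrix.of B * N) * M⁻¹ * (M * (Matrix.of C).transpose * E) = 1 := by
        calc _ = E.transpose * (Matrix.of B * N) * (M⁻¹ * M) * (Matrix.of C).transpose * E := by
              simp only [Matrix.mul_assoc]
          _ = E.transpose * (Matrix.of B * N * (Matrix.of C).transpose) * E := by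
              rw [Matrix.nonsing_inv_mul _ (isUnit_iff_ne_zero.2 hdet)]
              simp only [Matrix.mul_assoc, Matrix.mul_one]
          _ = 1 := by rw [hsum, Matrix.mul_one, hE]
      rwa [e, Matrix.rank_one, Fintype.card_fin] at this
    have := Matrix.rank_add_rank_le_card_of_mul_eq_zero h0
    simp at this
    omega

theorem continuous_slicePencil {n₁ n₂ n₃ : ℕ} : Continuous
    fun p : ((Fin n₁ × Fin n₂) × Fin n₃ → ℝ) × (Fin n₁ → ℝ) => slicePencil p.1 p.2 := by
  refine continuous_matrix fun j k => ?_
  simp only [slicePencil, Matrix.of_apply]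
  fun_prop

theorem slicePencil_smul {n₁ n₂ n₃ : ℕ} (S : (Fin n₁ × Fin n₂) × Fin n₃ → ℝ) (t : ℝ)
    (x : Fin n₁ → ℝ) : slicePencil S (t • x) = t • slicePencil S x := by
  ext j k
  simp [slicePencil, Finset.mul_sum, mul_assoc]

open Filter Topology in
/-- Definiteness of the determinant of the slice pencil is an open condition. -/
theorem eventually_det_slicePencil_ne_zero {n₁ n : ℕ} {S₀ : (Fin n₁ × Fin n) × Fin n → ℝ}
    (h : ∀ x, x ≠ 0 → (slicePencil S₀ x).det ≠ 0) :
    ∀ᶠ S in 𝓝 S₀, ∀ x, x ≠ 0 → (slicePencil S x).det ≠ 0 := by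
  have hs : ∀ᶠ S in 𝓝 S₀, ∀ x ∈ Metric.sphere (0 : Fin n₁ → ℝ) 1, (slicePencil S x).det ≠ 0 := by
    refine (isCompact_sphere _ _).eventually_forall_of_forall_eventually fun x hx => ?_
    refine (continuous_slicePencil.matrix_det.continuousAt (x := (S₀, x))).eventually_ne
      (h x ?_)
    rintro rfl
    simp at hx
  filter_upwards [hs] with S hS x hx hdet
  -- The determinant is homogeneous in `x`, so the unit sphere suffices.
  refine hS (‖x‖⁻¹ • x) ?_ ?_
  · simp [norm_smul, hx]
  · rw [slicePencil_smul, Matrix.det_smul, hdet, mul_zero]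

/-! ### The quaternion tensor -/

/-- The tensor of multiplication by imaginary quaternions on the quaternions. -/
def quaternionCoords (p : (Fin 3 × Fin 4) × Fin 4) : ℝ :=
  (![!![0, -1, 0, 0; 1, 0, 0, 0; 0, 0, 0, -1; 0, 0, 1, 0],
     !![0, 0, -1, 0; 0, 0, 0, 1; 1, 0, 0, 0; 0, -1, 0, 0],
     !![0, 0, 0, -1; 0, 0, -1, 0; 0, 1, 0, 0; 1, 0, 0, 0]] : Fin 3 → Matrix (Fin 4) (Fin 4) ℝ)
    p.1.1 p.1.2 p.2

theorem det_quaternionCoords_ne_zero (x : Fin 3 → ℝ) (hx : x ≠ 0) :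
    (slicePencil quaternionCoords x).det ≠ 0 := by
  have hM : slicePencil quaternionCoords x =
      !![0, -x 0, -x 1, -x 2; x 0, 0, -x 2, x 1; x 1, x 2, 0, -x 0; x 2, -x 1, x 0, 0] := by
    ext j k
    fin_cases j <;> fin_cases k <;> simp [slicePencil, quaternionCoords, Fin.sum_univ_three]
  -- Multiplicativity of the quaternion norm: left multiplication by `x` is a similarity.
  have hmul : (slicePencil quaternionCoords x).transpose * slicePencil quaternionCoords x =
      (x 0 ^ 2 + x 1 ^ 2 + x 2 ^ 2) • (1 : Matrix (Fin 4) (Fin 4) ℝ) := by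
    rw [hM]
    ext j k
    fin_cases j <;> fin_cases k <;> simp [Matrix.mul_apply, Fin.sum_univ_four] <;> ring
  have hpos : x 0 ^ 2 + x 1 ^ 2 + x 2 ^ 2 ≠ 0 := by
    intro h0
    apply hx
    funext i
    fin_cases i <;> simp <;> nlinarith [sq_nonneg (x 0), sq_nonneg (x 1), sq_nonneg (x 2)]
  intro hdet
  have := congrArg Matrix.det hmul
  rw [Matrix.det_mul, hdet, mul_zero, Matrix.det_smul, Matrix.det_one, mul_one] at this
  exact pow_ne_zero _ hpos this.symm

/-! ### Generic subrank at least two -/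

/-- The `4 × 4` matrix whose columns are the first two columns of the first two slices. -/
def cornerMatrix (S : (Fin 3 × Fin 4) × Fin 4 → ℝ) : Matrix (Fin 4) (Fin 4) ℝ :=
  Matrix.of fun j m => S ((![0, 0, 1, 1] m, j), ![0, 1, 0, 1] m)

/-- The four columns are independent vectors in the second factor, so functionals with any
prescribed values on them exist. The two needed are dual to column 0 of slice 0 and column 1 of
slice 1: rows 0 and 3 of the inverse. -/
theorem exists_contract_eq_of_det_cornerMatrix_ne_zero {S : (Fin 3 × Fin 4) × Fin 4 → ℝ}
    (h : (cornerMatrix S).det ≠ 0) :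
    ∃ (A : Fin 2 → Fin 3 → ℝ) (B C : Fin 2 → Fin 4 → ℝ), contract A B C S = unitCoord 2 := by
  let N := (cornerMatrix S)⁻¹
  have hN : N * cornerMatrix S = 1 := Matrix.nonsing_inv_mul _ (isUnit_iff_ne_zero.2 h)
  refine ⟨![![1, 0, 0], ![0, 1, 0]], ![N 0, N 3], ![![1, 0, 0, 0], ![0, 1, 0, 0]], ?_⟩
  have hNe (i m : Fin 4) := congrFun (congrFun hN i) m
  simp only [Matrix.mul_apply, Matrix.one_apply, cornerMatrix, Matrix.of_apply,
    Fin.sum_univ_four] at hNe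
  funext a b c
  have h0 := hNe 0
  have h3 := hNe 3
  fin_cases a <;> fin_cases b <;> fin_cases c <;>
    simp [contract, unitCoord, Fin.sum_univ_three, Fin.sum_univ_four] <;>
    first
      | simpa using h0 0
      | simpa using h0 1
      | simpa using h0 2
      | simpa using h0 3
      | simpa using h3 0
      | simpa using h3 1
      | simpa using h3 2
      | simpa using h3 3

theorem continuous_cornerMatrix : Continuous cornerMatrix :=
  continuous_matrix fun _ _ => continuous_apply _

theorem det_cornerMatrix_quaternionCoords : (cornerMatrix quaternionCoords).det ≠ 0 := by
  have : cornerMatrix quaternionCoords =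
      !![0, -1, 0, 0; 1, 0, 0, 0; 0, 0, 1, 0; 0, 0, 0, -1] := by
    ext j k
    fin_cases j <;> fin_cases k <;> simp [cornerMatrix, quaternionCoords]
  rw [this]
  simp [Matrix.det_succ_row_zero, Fin.sum_univ_succ, Fin.succAbove]

/-- A tensor whose corner matrix is the identity. -/
def cornerUnit (p : (Fin 3 × Fin 4) × Fin 4) : ℝ :=
  if (p = ((0, 0), 0) ∨ p = ((0, 1), 1)) ∨ (p = ((1, 2), 0) ∨ p = ((1, 3), 1)) then 1 else 0

theorem cornerMatrix_add_smul_cornerUnit (S : (Fin 3 × Fin 4) × Fin 4 → ℝ) (t : ℝ) :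
    cornerMatrix (S + t • cornerUnit) = cornerMatrix S + t • 1 := by
  ext j k
  fin_cases j <;> fin_cases k <;> simp [cornerMatrix, cornerUnit]

/-- On the line through `S` in direction `cornerUnit`, the determinant is a characteristic
polynomial in `t`; its finitely many roots leave parameters arbitrarily near 0. -/
theorem dense_det_cornerMatrix_ne_zero :
    Dense {S : (Fin 3 × Fin 4) × Fin 4 → ℝ | (cornerMatrix S).det ≠ 0} := by
  intro S
  have hfin : {t : ℝ | (cornerMatrix S + t • (1 : Matrix (Fin 4) (Fin 4) ℝ)).det = 0}.Finite := by
    refine ((-cornerMatrix S).charpoly.rootSet_finite ℝ).subset fun t ht => ?_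
    rw [Polynomial.mem_rootSet]
    refine ⟨(Matrix.charpoly_monic _).ne_zero, ?_⟩
    rw [Polynomial.coe_aeval_eq_eval, Matrix.eval_charpoly, sub_neg_eq_add, add_comm]
    rwa [Matrix.scalar_apply, ← Matrix.smul_one_eq_diagonal]
  have hd : Dense {t : ℝ | (cornerMatrix S + t • (1 : Matrix (Fin 4) (Fin 4) ℝ)).det = 0}ᶜ :=
    hfin.countable.dense_compl ℝ
  have hc : Continuous fun t : ℝ => S + t • cornerUnit := by fun_prop
  have := map_mem_closure hc (hd 0)
    (t := {S | (cornerMatrix S).det ≠ 0}) fun t ht => by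
      simpa [cornerMatrix_add_smul_cornerUnit] using ht
  simpa using this

/-! ### A stable tensor of subrank three -/

/-- A tensor restricting to the unit tensor of size three such that all nearby tensors do, too. -/
def stableCoords (p : (Fin 3 × Fin 4) × Fin 4) : ℝ :=
  if p = ((0, 0), 0) ∨ p = ((1, 1), 1) ∨ p = ((2, 2), 2) ∨
    p = ((2, 3), 1) ∨ p = ((0, 3), 2) ∨ p = ((1, 3), 0) ∨
    p = ((2, 1), 3) ∨ p = ((0, 2), 3) ∨ p = ((1, 0), 3) then 1 else 0

/-- The three matrices of a restriction. -/
abbrev RestrictionData : Type :=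
  (Fin 3 → Fin 3 → ℝ) × (Fin 3 → Fin 4 → ℝ) × (Fin 3 → Fin 4 → ℝ)

/-- The restriction to the corner `3 × 3 × 3`. -/
def cornerData : RestrictionData :=
  (fun a i => if a = i then 1 else 0, fun b j => if b.castSucc = j then 1 else 0,
    fun c k => if c.castSucc = k then 1 else 0)

/-- `contract` as a function of the pair of the restriction data and the tensor, paired with the
tensor. -/
def contractPair (q : RestrictionData × ((Fin 3 × Fin 4) × Fin 4 → ℝ)) :
    (Fin 3 → Fin 3 → Fin 3 → ℝ) × ((Fin 3 × Fin 4) × Fin 4 → ℝ) :=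
  (contract q.1.1 q.1.2.1 q.1.2.2 q.2, q.2)

theorem contDiff_contractPair : ContDiff ℝ 1 contractPair := by
  unfold contractPair contract
  refine ContDiff.prodMk ?_ contDiff_snd
  refine contDiff_pi.2 fun a => contDiff_pi.2 fun b => contDiff_pi.2 fun c => ?_
  fun_prop

/-- Used because `contract` is multilinear: it is affine when only one argument moves, so each
partial derivative is read off as a slope. -/
theorem fderiv_apply_eq_of_affine {E F : Type*} [NormedAddCommGroup E] [NormedSpace ℝ E]
    [NormedAddCommGroup F] [NormedSpace ℝ F] {f : E → F} {x v : E} {w : F}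
    (hf : DifferentiableAt ℝ f x) (h : ∀ t : ℝ, f (x + t • v) = f x + t • w) :
    fderiv ℝ f x v = w := by
  have h1 : HasLineDerivAt ℝ f (fderiv ℝ f x v) x v := hf.hasFDerivAt.hasLineDerivAt v
  have h2 : HasLineDerivAt ℝ f w x v := by
    unfold HasLineDerivAt
    simp only [h]
    simpa using ((hasDerivAt_id (0 : ℝ)).smul_const w).const_add (f x)
  exact h1.unique h2

theorem contract_corner_stable :
    contract cornerData.1 cornerData.2.1 cornerData.2.2 stableCoords = unitCoord 3 := by
  funext a b c
  simp only [contract, cornerData, ite_mul, one_mul, zero_mul, unitCoord]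
  fin_cases a <;> fin_cases b <;> fin_cases c <;> simp [stableCoords]

theorem contract_left_stable (A : Fin 3 → Fin 3 → ℝ) (a b c : Fin 3) :
    contract A cornerData.2.1 cornerData.2.2 stableCoords a b c = if b = c then A a b else 0 := by
  simp only [contract, cornerData, mul_ite, mul_one, mul_zero, ite_mul, zero_mul,
    Finset.sum_ite_eq, Finset.mem_univ, if_true, Fin.sum_univ_three]
  fin_cases b <;> fin_cases c <;> simp [stableCoords]

theorem contract_middle_stable (B : Fin 3 → Fin 4 → ℝ) (a b c : Fin 3) :
    contract cornerData.1 B cornerData.2.2 stableCoords a b c =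
      (if a = c then B b a.castSucc else 0) + if c = a + 2 then B b 3 else 0 := by
  simp only [contract, cornerData, mul_ite, mul_one, mul_zero, ite_mul, zero_mul, one_mul,
    Finset.sum_ite_eq, Finset.sum_ite_irrel, Finset.sum_const_zero, Finset.mem_univ, if_true,
    Fin.sum_univ_four]
  fin_cases a <;> fin_cases c <;> simp [stableCoords]

theorem contract_right_stable (C : Fin 3 → Fin 4 → ℝ) (a b c : Fin 3) :
    contract cornerData.1 cornerData.2.1 C stableCoords a b c =
      (if a = b then C c a.castSucc else 0) + if b = a + 2 then C c 3 else 0 := by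
  simp only [contract, cornerData, mul_ite, mul_one, mul_zero, ite_mul, zero_mul, one_mul,
    Finset.sum_ite_eq, Finset.sum_ite_irrel, Finset.sum_const_zero, Finset.mem_univ, if_true,
    Fin.sum_univ_four]
  fin_cases a <;> fin_cases b <;> simp [stableCoords]

/-- Varying `A`, `B`, `C` adjusts the entries with `b = c`, `a = c`, `a = b` respectively. The six
entries with distinct indices form two cyclic classes, reached through the fourth coordinates of `B`
and `C`; this is what the off-diagonal ones of `stableCoords` provide. -/
theorem exists_contract_variation (X : Fin 3 → Fin 3 → Fin 3 → ℝ) :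
    ∃ (A : Fin 3 → Fin 3 → ℝ) (B C : Fin 3 → Fin 4 → ℝ),
      contract A cornerData.2.1 cornerData.2.2 stableCoords +
        contract cornerData.1 B cornerData.2.2 stableCoords +
        contract cornerData.1 cornerData.2.1 C stableCoords = X := by
  -- `β` and `γ` are forced by the entries with distinct indices. They also spill onto entries with
  -- a repeated index, hence the subtracted terms below; the diagonal is left to `A`.
  let β (b : Fin 3) : ℝ := X (b + 2) b (b + 1)
  let γ (c : Fin 3) : ℝ := X (c + 2) (c + 1) c
  refine ⟨fun a b => X a b b - if b = a + 2 then β b + γ b else 0,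
    fun b => Fin.snoc (α := fun _ => ℝ)
      (fun a => if a = b then 0 else X a b a - if b = a + 2 then γ a else 0) (β b),
    fun c => Fin.snoc (α := fun _ => ℝ)
      (fun a => if a = c then 0 else X a a c - if c = a + 2 then β a else 0) (γ c), ?_⟩
  funext a b c
  rw [Pi.add_apply, Pi.add_apply, Pi.add_apply, Pi.add_apply, Pi.add_apply, Pi.add_apply,
    contract_left_stable, contract_middle_stable, contract_right_stable,
    show (3 : Fin 4) = Fin.last 3 from rfl]
  simp only [Fin.snoc_castSucc, Fin.snoc_last, β, γ]
  fin_cases a <;> fin_cases b <;> fin_cases c <;> simp <;> ring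

theorem fderiv_contractPair_surjective :
    (fderiv ℝ contractPair (cornerData, stableCoords)).range = ⊤ := by
  have hd : DifferentiableAt ℝ contractPair (cornerData, stableCoords) :=
    (contDiff_contractPair.differentiable one_ne_zero).differentiableAt
  rw [LinearMap.range_eq_top]
  rintro ⟨X, S⟩
  obtain ⟨A, B, C, h⟩ := exists_contract_variation
    (X - contract cornerData.1 cornerData.2.1 cornerData.2.2 S)
  have hA : fderiv ℝ contractPair (cornerData, stableCoords) ((A, 0, 0), 0) =
      (contract A cornerData.2.1 cornerData.2.2 stableCoords, 0) :=
    fderiv_apply_eq_of_affine hd fun t => by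
      refine Prod.ext ?_ (by simp [contractPair])
      funext a b c
      simp [contractPair, contract, add_mul, Finset.sum_add_distrib, Finset.mul_sum,
        mul_assoc]
  have hB : fderiv ℝ contractPair (cornerData, stableCoords) ((0, B, 0), 0) =
      (contract cornerData.1 B cornerData.2.2 stableCoords, 0) :=
    fderiv_apply_eq_of_affine hd fun t => by
      refine Prod.ext ?_ (by simp [contractPair])
      funext a b c
      simp [contractPair, contract, add_mul, mul_add, Finset.sum_add_distrib, Finset.mul_sum,
        mul_assoc, mul_left_comm]
  have hC : fderiv ℝ contractPair (cornerData, stableCoords) ((0, 0, C), 0) =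
      (contract cornerData.1 cornerData.2.1 C stableCoords, 0) :=
    fderiv_apply_eq_of_affine hd fun t => by
      refine Prod.ext ?_ (by simp [contractPair])
      funext a b c
      simp [contractPair, contract, add_mul, mul_add, Finset.sum_add_distrib, Finset.mul_sum,
        mul_assoc, mul_left_comm]
  have hS : fderiv ℝ contractPair (cornerData, stableCoords) (0, S) =
      (contract cornerData.1 cornerData.2.1 cornerData.2.2 S, S) :=
    fderiv_apply_eq_of_affine hd fun t => by
      refine Prod.ext ?_ (by simp [contractPair])
      funext a b c
      simp [contractPair, contract, mul_add, Finset.sum_add_distrib, Finset.mul_sum,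
        mul_assoc, mul_left_comm]
  refine ⟨((A, 0, 0), 0) + ((0, B, 0), 0) + ((0, 0, C), 0) + (0, S), ?_⟩
  rw [map_add, map_add, map_add]
  simp only [ContinuousLinearMap.coe_coe, hA, hB, hC, hS, Prod.mk_add_mk, h, add_zero, zero_add,
    sub_add_cancel]

-- Keeping `S` as a second component of `contractPair` makes local surjectivity give a solution for
-- each nearby `S`, with the target fixed at the unit tensor.
open Filter Topology in
theorem eventually_exists_contract_eq :
    ∀ᶠ S in 𝓝 stableCoords, ∃ (A : Fin 3 → Fin 3 → ℝ) (B C : Fin 3 → Fin 4 → ℝ),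
      contract A B C S = unitCoord 3 := by
  have hmap := (contDiff_contractPair.contDiffAt.hasStrictFDerivAt
    one_ne_zero).map_nhds_eq_of_surj fderiv_contractPair_surjective
  have hmem : Set.range contractPair ∈ 𝓝 (contractPair (cornerData, stableCoords)) := by
    rw [← hmap]
    exact range_mem_map
  have hc : Tendsto (fun S : (Fin 3 × Fin 4) × Fin 4 → ℝ => (unitCoord 3, S)) (𝓝 stableCoords)
      (𝓝 (contractPair (cornerData, stableCoords))) := by
    rw [contractPair, contract_corner_stable]
    exact (Continuous.prodMk_right _).continuousAt
  filter_upwards [hc hmem] with S hS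
  obtain ⟨⟨⟨A, B, C⟩, S'⟩, h⟩ := hS
  obtain ⟨h1, rfl⟩ := Prod.ext_iff.1 h
  exact ⟨A, B, C, h1⟩

/-! ### Transfer to tensors and conclusion -/

theorem le_subrank {n₁ n₂ n₃ r : ℕ} {T : RealTensor n₁ n₂ n₃} {A : Fin r → Fin n₁ → ℝ}
    {B : Fin r → Fin n₂ → ℝ} {C : Fin r → Fin n₃ → ℝ}
    (h : contract A B C (tensorCoords n₁ n₂ n₃ T) = unitCoord r) : r ≤ subrank T :=
  (subrank_isGreatest T).2 ((restrictsToUnit_iff T r).2 ⟨A, B, C, h⟩)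

instance (n₁ n₂ n₃ : ℕ) : ContinuousSMul ℝ (RealTensor n₁ n₂ n₃) :=
  (inferInstance : NormedSpace ℝ (RealTensor n₁ n₂ n₃)).toIsBoundedSMul.continuousSMul

instance (n₁ n₂ n₃ : ℕ) : T2Space (RealTensor n₁ n₂ n₃) :=
  letI : MetricSpace (RealTensor n₁ n₂ n₃) := NormedAddCommGroup.toMetricSpace
  inferInstance

/-- `tensorCoords` as a homeomorphism. -/
noncomputable def tensorCoordsHomeomorph (n₁ n₂ n₃ : ℕ) :
    RealTensor n₁ n₂ n₃ ≃ₜ ((Fin n₁ × Fin n₂) × Fin n₃ → ℝ) :=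
  (tensorCoords n₁ n₂ n₃).toContinuousLinearEquiv.toHomeomorph

open Filter Topology in
theorem isTypicalSubrank_of_eventually {n₁ n₂ n₃ r : ℕ} {S₀ : (Fin n₁ × Fin n₂) × Fin n₃ → ℝ}
    (h : ∀ᶠ S in 𝓝 S₀, ∀ T, tensorCoords n₁ n₂ n₃ T = S → subrank T = r) :
    IsTypicalSubrank n₁ n₂ n₃ r := by
  obtain ⟨U, hU, hUo, hmem⟩ := eventually_nhds_iff.1 h
  refine ⟨tensorCoordsHomeomorph n₁ n₂ n₃ ⁻¹' U,
    hUo.preimage (tensorCoordsHomeomorph n₁ n₂ n₃).continuous,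
    ⟨(tensorCoordsHomeomorph n₁ n₂ n₃).symm S₀, ?_⟩, fun T hT => hU _ hT T rfl⟩
  simpa using hmem

theorem two_le_of_isTypicalSubrank {r : ℕ} (h : IsTypicalSubrank 3 4 4 r) : 2 ≤ r := by
  obtain ⟨U, hUo, hne, hU⟩ := h
  obtain ⟨S, hS, hSU⟩ := dense_det_cornerMatrix_ne_zero.inter_open_nonempty _
    (hUo.preimage (tensorCoordsHomeomorph 3 4 4).symm.continuous)
    (hne.preimage (tensorCoordsHomeomorph 3 4 4).symm.surjective)
  obtain ⟨A, B, C, hABC⟩ := exists_contract_eq_of_det_cornerMatrix_ne_zero hSU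
  rw [← hU hS]
  refine le_subrank (A := A) (B := B) (C := C) ?_
  rw [← hABC]
  congr 1
  exact (tensorCoordsHomeomorph 3 4 4).apply_symm_apply S

theorem isTypicalSubrank_two : IsTypicalSubrank 3 4 4 2 := by
  refine isTypicalSubrank_of_eventually (S₀ := quaternionCoords) ?_
  filter_upwards [eventually_det_slicePencil_ne_zero det_quaternionCoords_ne_zero,
    continuous_cornerMatrix.matrix_det.continuousAt.eventually_ne
      det_cornerMatrix_quaternionCoords] with S hS hS' T hT
  subst hT
  obtain ⟨A, B, C, hABC⟩ := exists_contract_eq_of_det_cornerMatrix_ne_zero hS'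
  refine le_antisymm ?_ (le_subrank hABC)
  by_contra! hlt
  obtain ⟨A, B, C, h⟩ := (restrictsToUnit_iff T 3).1 ((subrank_isGreatest T).1.mono hlt)
  obtain ⟨hA, hdet⟩ := exists_det_slicePencil_eq_zero h
  exact hS _ hA hdet

theorem isTypicalSubrank_three : IsTypicalSubrank 3 4 4 3 := by
  refine isTypicalSubrank_of_eventually (S₀ := stableCoords) ?_
  filter_upwards [eventually_exists_contract_eq] with S ⟨A, B, C, h⟩ T hT
  subst hT
  exact le_antisymm (subrank_le_left T) (le_subrank h)

theorem corollary4p12 : {r : ℕ | IsTypicalSubrank 3 4 4 r} = {2, 3} := by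
  ext r
  simp only [Set.mem_ofPred_eq, Set.mem_insert_iff, Set.mem_singleton_iff]
  constructor
  · intro h
    have h2 := two_le_of_isTypicalSubrank h
    obtain ⟨U, -, ⟨T, hT⟩, hU⟩ := h
    have h3 := subrank_le_left T
    rw [hU hT] at h3
    omega
  · rintro (rfl | rfl)
    exacts [isTypicalSubrank_two, isTypicalSubrank_three]
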